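/- **Theorem 1 (rate region of independent network-then-channel decoding).** Consider four independent memoryless binary symmetric channels (BSCs) $1\to3$, $2\to3$, $3\to4$, $1\to4$ with crossover probabilities $p_{1,3},p_{2,3},p_{3,4},p_{1,4}\in[0,1]$. For block length $n$ and rates $R_A,R_B\ge 0$, independent messages $A,B$ are uniform on $\{1,\dots,\lfloor 2^{nR_A}\rfloor\}$ and $\{1,\dots,\lfloor 2^{nR_B}\rfloor\}$. Node 1 sends the same codeword $\mathbf X_{1,3}(A)=\mathbf X_{1,4}(A)\in\{0,1\}^n$ on its two links, node 2 sends $\mathbf X_{2,3}(B)\in\{0,1\}^n$, and node 3 sends $\mathbf X_{3,4}=\mathbf Y_{1,3}\oplus\mathbf Y_{2,3}$, where $\mathbf Y_{i,j}$ is the output of link $i\to j$. Node 4 computes $\hat A$ from $\mathbf Y_{1,4}$ alone and $\hat B$ from $\mathbf Y_{3,4}\oplus\mathbf Y_{1,4}$ alone. Call $(R_A,R_B)$ achievable if for every $\varepsilon>0$ and all sufficiently large $n$ there are encoders and decoders of this form with $\Pr\{(\hat A,\hat B)\ne(A,B)\}<\varepsilon$, and let the achievable rate region $\Lambda_{\rm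 nc}$ be the closure of the set of achievable pairs. Let $H(p)=-p\log_2p-(1-p)\log_2(1-p)$ (with $0\log_2 0=0$) and $$\begin{aligned}p''={}&p_{1,3}(1-p_{2,3})(1-p_{3,4})(1-p_{1,4})+(1-p_{1,3})p_{2,3}(1-p_{3,4})(1-p_{1,4})\\&+(1-p_{1,3})(1-p_{2,3})p_{3,4}(1-p_{1,4})+(1-p_{1,3})(1-p_{2,3})(1-p_{3,4})p_{1,4}\\&+(1-p_{1,3})p_{2,3}p_{3,4}p_{1,4}+p_{1,3}(1-p_{2,3})p_{3,4}p_{1,4}\\&+p_{1,3}p_{2,3}(1-p_{3,4})p_{1,4}+p_{1,3}p_{2,3}p_{3,4}(1-p_{1,4}).\end{aligned}$$ Then, for all $n$ and whatever codeword node 1 sends, the channel from $\mathbf X_{2,3}$ to $\mathbf Y_{3,4}\oplus\mathbf Y_{1,4}$ is a memoryless BSC with crossover probability $p''$; the numbers $\mathbb C_{1,4}=1-H(p_{1,4})$ and $\mathbb C''=1-H(p'')$ are the capacities (suprema of achievable rates) of the BSCs with crossover probabilities $p_{1,4}$ and $p''$; and $\Lambda_{\rm nc}$ is exactly the convex hull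 of all $(R_A,R_B)$ with $R_A,R_B\ge0$, $R_A\le\mathbb C_{1,4}$ and $R_B\le\mathbb C''$. The region is the same if both encoders are required to be linear, that is, if messages are labelled by distinct binary vectors $\mathbf u$ of the least possible length and encoded as $\mathbf uG$ for a generator matrix $G$ over $\mathbb F_2$. -/

import Mathlib

noncomputable section

namespace RelayNet

/-- Binary words of length `n`; addition is bitwise XOR. -/
abbrev Word (n : ℕ) : Type := Fin n → ZMod 2

/-- The four links of the network: sources at nodes 1 and 2, relay at node 3, destination at
node 4; `l13` is the link from node 1 to node 3, and so on. -/
inductive Link : Type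
  | l13 | l23 | l34 | l14
  deriving DecidableEq

instance : Fintype Link where
  elems := {Link.l13, Link.l23, Link.l34, Link.l14}
  complete := by intro l; cases l <;> decide

/-- Binary entropy in bits. -/
def entropy₂ (p : ℝ) : ℝ := Real.binEntropy p / Real.log 2

/-- Transition probability of a binary symmetric channel: input `x`, output `y`. -/
def bsc (p : ℝ) (x y : ZMod 2) : ℝ := if y = x then 1 - p else p

/-- Block transition probability of the memoryless binary symmetric channel. -/
def bscBlock (p : ℝ) {n : ℕ} (x y : Word n) : ℝ := ∏ i, bsc p (x i) (y i)

/-- Size of the message alphabet `{1, …, ⌊2 ^ (n R)⌋}` at block length `n` and rate `R`. -/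
def numMsg (n : ℕ) (R : ℝ) : ℕ := ⌊(2 : ℝ) ^ ((n : ℝ) * R)⌋₊

/-! ### Point-to-point coding over a binary symmetric channel -/

/-- A block code: an encoder and a decoder for `M` messages. -/
structure BlockCode (n M : ℕ) where
  /-- the encoder -/
  enc : Fin M → Word n
  /-- the decoder -/
  dec : Word n → Fin M

/-- Error probability over a binary symmetric channel, for a uniformly chosen message. -/
def BlockCode.errorProb {n M : ℕ} (c : BlockCode n M) (p : ℝ) : ℝ :=
  (∑ m : Fin M, ∑ y : Word n, if c.dec y ≠ m then bscBlock p (c.enc m) y else 0) / (M : ℝ)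

/-- `R` is an achievable rate over the binary symmetric channel with crossover probability `p`:
the error probability can be made arbitrarily small at all large block lengths. -/
def BSCAchievable (p R : ℝ) : Prop :=
  0 ≤ R ∧ ∀ ε : ℝ, 0 < ε → ∀ᶠ n : ℕ in Filter.atTop,
    ∃ c : BlockCode n (numMsg n R), c.errorProb p < ε

/-- `C` is the capacity of the binary symmetric channel with crossover probability `p`. -/
def IsBSCCapacity (p C : ℝ) : Prop := IsLUB {R : ℝ | BSCAchievable p R} C

/-! ### The network -/

/-- Error patterns on the four links during `n` channel uses. -/
abbrev Noise (n : ℕ) : Type := Link → Word n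

/-- Probability of an error pattern: independent over links and channel uses, a bit on link `l`
being flipped with probability `p l`. -/
def noiseProb (p : Link → ℝ) {n : ℕ} (e : Noise n) : ℝ :=
  ∏ l, ∏ i, if e l i = 1 then p l else 1 - p l

/-- Node 4's observation `Y₁₄` when node 1 sends `xA` on both its links. -/
def Y14 {n : ℕ} (xA : Word n) (e : Noise n) : Word n := xA + e Link.l14

/-- Node 3's observation on the link from node 1. -/
def Y13 {n : ℕ} (xA : Word n) (e : Noise n) : Word n := xA + e Link.l13

/-- Node 3's observation on the link from node 2. -/
def Y23 {n : ℕ} (xB : Word n) (e : Noise n) : Word n := xB + e Link.l23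

/-- The relay transmits the XOR of its two observations. -/
def X34 {n : ℕ} (xA xB : Word n) (e : Noise n) : Word n := Y13 xA e + Y23 xB e

/-- Node 4's observation `Y₃₄` on the link from the relay. -/
def Y34 {n : ℕ} (xA xB : Word n) (e : Noise n) : Word n := X34 xA xB e + e Link.l34

/-- A code for independent network-then-channel decoding. Node 1 has a single encoder for both its
outgoing links. -/
structure NCCode (n MA MB : ℕ) where
  /-- encoder of node 1 -/
  encA : Fin MA → Word n
  /-- encoder of node 2 -/
  encB : Fin MB → Word n
  /-- decoder for `A`, to be applied to `Y₁₄` -/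
  decA : Word n → Fin MA
  /-- decoder for `B`, to be applied to `Y₃₄ + Y₁₄` -/
  decB : Word n → Fin MB

/-- The estimates `(Â, B̂)` formed by node 4 when the messages are `a`, `b` and the noise is `e`. -/
def NCCode.estimate {n MA MB : ℕ} (c : NCCode n MA MB) (a : Fin MA) (b : Fin MB) (e : Noise n) :
    Fin MA × Fin MB :=
  (c.decA (Y14 (c.encA a) e), c.decB (Y34 (c.encA a) (c.encB b) e + Y14 (c.encA a) e))

/-- The probability that `(Â, B̂) ≠ (A, B)` for independent uniform messages `A`, `B`. -/
def NCCode.errorProb {n MA MB : ℕ} (c : NCCode n MA MB) (p : Link → ℝ) : ℝ :=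
  (∑ a : Fin MA, ∑ b : Fin MB, ∑ e : Noise n,
    if c.estimate a b e ≠ (a, b) then noiseProb p e else 0) / ((MA : ℝ) * (MB : ℝ))

/-- An encoder for `M` messages is linear if the messages, represented by distinct binary vectors
of the least possible length `k = ⌈log₂ M⌉`, are encoded by `u ↦ u G` with a generator matrix
`G`. -/
def IsLinearEncoder {n M : ℕ} (f : Fin M → Word n) : Prop :=
  ∃ (G : Matrix (Fin (Nat.clog 2 M)) (Fin n) (ZMod 2)) (u : Fin M → Word (Nat.clog 2 M)),
    Function.Injective u ∧ ∀ m, f m = Matrix.vecMul (u m) G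

/-- The code uses linear codes at both sources. -/
def NCCode.IsLinear {n MA MB : ℕ} (c : NCCode n MA MB) : Prop :=
  IsLinearEncoder c.encA ∧ IsLinearEncoder c.encB

/-- The rate pair `R = (R_A, R_B)` is achievable by independent network-then-channel decoding. -/
def NCAchievable (p : Link → ℝ) (R : ℝ × ℝ) : Prop :=
  0 ≤ R.1 ∧ 0 ≤ R.2 ∧ ∀ ε : ℝ, 0 < ε → ∀ᶠ n : ℕ in Filter.atTop,
    ∃ c : NCCode n (numMsg n R.1) (numMsg n R.2), c.errorProb p < ε

/-- The rate pair `R = (R_A, R_B)` is achievable by independent network-then-channel decoding with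
linear codes. -/
def NCLinearAchievable (p : Link → ℝ) (R : ℝ × ℝ) : Prop :=
  0 ≤ R.1 ∧ 0 ≤ R.2 ∧ ∀ ε : ℝ, 0 < ε → ∀ᶠ n : ℕ in Filter.atTop,
    ∃ c : NCCode n (numMsg n R.1) (numMsg n R.2), c.IsLinear ∧ c.errorProb p < ε

/-- The achievable rate region: the closure of the set of achievable rate pairs. -/
def ncRegion (p : Link → ℝ) : Set (ℝ × ℝ) := closure {R | NCAchievable p R}

/-- The achievable rate region when only linear codes are used. -/
def ncLinearRegion (p : Link → ℝ) : Set (ℝ × ℝ) := closure {R | NCLinearAchievable p R}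

/-- The crossover probability `p''` of the equivalent channel. -/
def pEquiv (p : Link → ℝ) : ℝ :=
  p .l13 * (1 - p .l23) * (1 - p .l34) * (1 - p .l14)
  + (1 - p .l13) * p .l23 * (1 - p .l34) * (1 - p .l14)
  + (1 - p .l13) * (1 - p .l23) * p .l34 * (1 - p .l14)
  + (1 - p .l13) * (1 - p .l23) * (1 - p .l34) * p .l14
  + (1 - p .l13) * p .l23 * p .l34 * p .l14
  + p .l13 * (1 - p .l23) * p .l34 * p .l14
  + p .l13 * p .l23 * (1 - p .l34) * p .l14
  + p .l13 * p .l23 * p .l34 * (1 - p .l14)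

end RelayNet

end

namespace RelayNet

open Filter Topology

/-! ### Real-analytic preliminaries -/

/-! Over `ZMod 2` the codeword of node 1 cancels in `Y34 + Y14`, leaving the codeword of node 2 plus
the sum of the four link noises. A bit of that sum is 1 exactly when an odd number of links flip it,
which has probability `pEquiv p`. The network error event is the union of the two decoding errors,
so its probability is at least each of theirs and at most their sum. The two errors are dependent,
since both involve the noise on `l14`, but these bounds need no independence. Hence the achievable
pairs form a product (`ncAchievable_iff`, `ncLinearAchievable_iff`), whose closure is a rectangle
and already convex.

What remains is the coding theorem for one binary symmetric channel, with linear codes in the direct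
part. Both halves are Chernoff bounds on the block likelihood `W`: the sum of `W ^ s` over outputs
is the `n`th power of `(1 - p) ^ s + p ^ s`, whose derivative at `s = 1` is minus the entropy times
`log 2`. The converse (`one_sub_errorProb_le`) truncates `W` at a threshold and counts outputs; the
direct part (`exists_isLinearEncoder_errorProb_le`) averages threshold decoding over all generator
matrices. -/

theorem hasDerivAt_rpow_const_base {a : ℝ} (ha : 0 ≤ a) :
    HasDerivAt (fun s : ℝ => a ^ (1 + s)) (a * Real.log a) 0 := by
  rcases ha.eq_or_lt with rfl | ha
  -- Near `s = 0` the exponent is nonzero, so the power vanishes; this is `0 log 0 = 0`, and it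
  -- admits `p = 0` and `p = 1`.
  · have h : (fun s : ℝ => (0 : ℝ) ^ (1 + s)) =ᶠ[𝓝 0] fun _ => 0 := by
      filter_upwards [lt_mem_nhds (show (-1 : ℝ) < 0 by norm_num)] with s hs
      exact Real.zero_rpow (by linarith)
    simpa using (hasDerivAt_const (0 : ℝ) (0 : ℝ)).congr_of_eventuallyEq h
  · have h := ((hasDerivAt_id (0 : ℝ)).const_add 1).const_rpow ha
    simpa [mul_comm] using h

/-- The function equals 1 at `s = 0`, so the sign of `c - entropy₂ p` decides on which side it dips
below 1. That value below 1 is the ratio of geometric decay in the block length. -/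
theorem hasDerivAt_powerSum_mul {p : ℝ} (hp : 0 ≤ p ∧ p ≤ 1) (c : ℝ) :
    HasDerivAt (fun s : ℝ => ((1 - p) ^ (1 + s) + p ^ (1 + s)) * ((2 : ℝ) ^ c) ^ s)
      ((c - entropy₂ p) * Real.log 2) 0 := by
  have h1 := (hasDerivAt_rpow_const_base (sub_nonneg.2 hp.2)).add
    (hasDerivAt_rpow_const_base hp.1)
  have h2 := (hasDerivAt_id (0 : ℝ)).const_rpow (show (0 : ℝ) < 2 ^ c by positivity)
  have h := h1.mul h2
  refine h.congr_deriv ?_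
  have hl : Real.log 2 ≠ 0 := (Real.log_pos one_lt_two).ne'
  simp only [entropy₂, Real.binEntropy, Real.log_inv, id, Real.log_rpow two_pos, Pi.add_apply,
    add_zero, Real.rpow_one, Real.rpow_zero]
  field_simp
  ring

theorem eventually_lt_of_hasDerivAt_neg {f : ℝ → ℝ} {d : ℝ} (h : HasDerivAt f d 0) (hd : d < 0) :
    ∀ᶠ t in 𝓝[>] (0 : ℝ), f t < f 0 := by
  have h1 := (hasDerivAt_iff_tendsto_slope.1 h).eventually (gt_mem_nhds hd)
  have h2 := h1.filter_mono (nhdsWithin_mono (0 : ℝ) (fun x (hx : 0 < x) => hx.ne'))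
  filter_upwards [h2, self_mem_nhdsWithin] with t ht (h0 : 0 < t)
  rw [slope_def_field, sub_zero, div_neg_iff] at ht
  rcases ht with ht | ht <;> linarith [ht.1, ht.2]

theorem exists_powerSum_above_lt {p : ℝ} (hp : 0 ≤ p ∧ p ≤ 1) {c : ℝ} (hc : c < entropy₂ p) :
    ∃ t : ℝ, 0 < t ∧ ((1 - p) ^ (1 + t) + p ^ (1 + t)) * ((2 : ℝ) ^ c) ^ t < 1 := by
  have h := eventually_lt_of_hasDerivAt_neg (hasDerivAt_powerSum_mul hp c)
    (mul_neg_of_neg_of_pos (sub_neg.2 hc) (Real.log_pos one_lt_two))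
  obtain ⟨t, ht, h0⟩ := (h.and self_mem_nhdsWithin).exists
  exact ⟨t, h0, by simpa using ht⟩

theorem exists_powerSum_below_lt {p : ℝ} (hp : 0 ≤ p ∧ p ≤ 1) {c : ℝ} (hc : entropy₂ p < c) :
    ∃ t : ℝ, 0 < t ∧ t < 1 ∧
      ((1 - p) ^ (1 - t) + p ^ (1 - t)) * ((2 : ℝ) ^ (-c)) ^ t < 1 := by
  have h0 := hasDerivAt_powerSum_mul hp c
  -- The base point is written `-0` so that the derivative composes with `t ↦ -t` at 0.
  rw [← neg_zero] at h0
  have h := eventually_lt_of_hasDerivAt_neg (h0.scomp (0 : ℝ) (hasDerivAt_neg (0 : ℝ)))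
    (by simpa using mul_pos (sub_pos.2 hc) (Real.log_pos one_lt_two))
  obtain ⟨t, ⟨ht, ht1⟩, ht0⟩ :=
    ((h.and (nhdsWithin_le_nhds (gt_mem_nhds one_pos))).and self_mem_nhdsWithin).exists
  refine ⟨t, ht0, ht1, ?_⟩
  rw [Real.rpow_neg two_pos.le, Real.inv_rpow (by positivity), ← Real.rpow_neg (by positivity)]
  simpa [sub_eq_add_neg] using ht

/-- Either `W ≤ θ`, or the factor `(W / θ) ^ t` is at least 1. -/
theorem le_add_rpow_mul {W θ t : ℝ} (hW : 0 ≤ W) (hθ : 0 < θ) (ht : 0 ≤ t) :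
    W ≤ θ + W ^ (1 + t) * θ⁻¹ ^ t := by
  rcases le_or_gt W θ with h | h
  · have : 0 ≤ W ^ (1 + t) * θ⁻¹ ^ t := by positivity
    linarith
  · have hW' : 0 < W := hθ.trans h
    have h1 : 1 ≤ (W * θ⁻¹) ^ t :=
      Real.one_le_rpow (by rw [← div_eq_mul_inv, one_le_div hθ]; exact h.le) ht
    rw [Real.rpow_add hW', Real.rpow_one, mul_assoc, ← Real.mul_rpow hW (by positivity)]
    nlinarith

theorem le_rpow_mul_of_le {W θ t : ℝ} (hW : 0 ≤ W) (h : W ≤ θ) (ht : 0 ≤ t) :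
    W ≤ W ^ (1 - t) * θ ^ t := by
  calc W = W ^ (1 - t) * W ^ t := by
        rw [← Real.rpow_add' hW (by norm_num), sub_add_cancel, Real.rpow_one]
    _ ≤ _ := by gcongr

theorem numMsg_le (n : ℕ) (R : ℝ) : (numMsg n R : ℝ) ≤ ((2 : ℝ) ^ R) ^ n := by
  rw [← Real.rpow_natCast, ← Real.rpow_mul two_pos.le, mul_comm]
  exact Nat.floor_le (by positivity)

theorem one_le_numMsg (n : ℕ) {R : ℝ} (hR : 0 ≤ R) : 1 ≤ numMsg n R :=
  Nat.le_floor (by simpa using Real.one_le_rpow one_le_two (by positivity : 0 ≤ (n : ℝ) * R))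

theorem le_two_mul_numMsg (n : ℕ) {R : ℝ} (hR : 0 ≤ R) :
    ((2 : ℝ) ^ R) ^ n ≤ 2 * numMsg n R := by
  have h1 : (1 : ℝ) ≤ numMsg n R := by exact_mod_cast one_le_numMsg n hR
  -- Since the floor is at least 1, rounding down loses at most a factor of 2.
  have h2 := Nat.lt_floor_add_one ((2 : ℝ) ^ ((n : ℝ) * R))
  rw [← Real.rpow_natCast, ← Real.rpow_mul two_pos.le, mul_comm R]
  change _ < (numMsg n R : ℝ) + 1 at h2
  linarith

theorem numMsg_zero_right (n : ℕ) : numMsg n 0 = 1 := by simp [numMsg]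

theorem entropy₂_le_one (p : ℝ) : entropy₂ p ≤ 1 :=
  div_le_one_of_le₀ Real.binEntropy_le_log_two (Real.log_nonneg one_le_two)

/-! ### The binary symmetric channel -/

theorem bsc_nonneg {p : ℝ} (hp : 0 ≤ p ∧ p ≤ 1) (x y : ZMod 2) : 0 ≤ bsc p x y := by
  unfold bsc; split_ifs <;> linarith [hp.1, hp.2]

theorem bscBlock_nonneg {p : ℝ} (hp : 0 ≤ p ∧ p ≤ 1) {n : ℕ} (x y : Word n) :
    0 ≤ bscBlock p x y :=
  Finset.prod_nonneg fun _ _ => bsc_nonneg hp _ _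

theorem sum_zmod_two (f : ZMod 2 → ℝ) : ∑ a, f a = f 0 + f 1 := Fin.sum_univ_two f

theorem zmod_two_eq_zero_or_one : ∀ x : ZMod 2, x = 0 ∨ x = 1 := by decide

theorem sum_bsc (p : ℝ) (f : ℝ → ℝ) (x : ZMod 2) :
    ∑ y, f (bsc p x y) = f (1 - p) + f p := by
  rw [sum_zmod_two]
  rcases zmod_two_eq_zero_or_one x with rfl | rfl
  · simp [bsc]
  · simp [bsc, add_comm]

theorem sum_bscBlock_rpow {p : ℝ} (hp : 0 ≤ p ∧ p ≤ 1) {n : ℕ} (x : Word n) (s : ℝ) :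
    ∑ y, bscBlock p x y ^ s = ((1 - p) ^ s + p ^ s) ^ n := by
  have h : ∀ y : Word n, bscBlock p x y ^ s = ∏ i, bsc p (x i) (y i) ^ s := fun y =>
    (Real.finsetProd_rpow _ _ (fun _ _ => bsc_nonneg hp _ _) _).symm
  simp_rw [h]
  rw [← Fintype.prod_sum (fun i y => bsc p (x i) y ^ s)]
  simp [sum_bsc p (· ^ s)]

theorem sum_bscBlock {p : ℝ} (hp : 0 ≤ p ∧ p ≤ 1) {n : ℕ} (x : Word n) :
    ∑ y, bscBlock p x y = 1 := by
  simpa using sum_bscBlock_rpow hp x 1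

theorem bscBlock_add_left (p : ℝ) {n : ℕ} (x e : Word n) :
    bscBlock p x (x + e) = bscBlock p 0 e := by
  simp [bscBlock, bsc]

theorem card_word (n : ℕ) : Fintype.card (Word n) = 2 ^ n := by simp [ZMod.card]

/-! ### Converse -/

/-- Each output is decoded to exactly one message, so likelihoods capped at `θ` contribute at most
`2 ^ n * θ` to correct decoding, summed over all messages. The excess above `θ` is bounded by the
power sum. -/
theorem one_sub_errorProb_le {p : ℝ} (hp : 0 ≤ p ∧ p ≤ 1) {n M : ℕ} (hM : 0 < M)
    (c : BlockCode n M) {θ t : ℝ} (hθ : 0 < θ) (ht : 0 < t) :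
    1 - c.errorProb p ≤
      2 ^ n * θ / M + ((1 - p) ^ (1 + t) + p ^ (1 + t)) ^ n * θ⁻¹ ^ t := by
  have hM' : (0 : ℝ) < M := by exact_mod_cast hM
  have h1 : ∀ m : Fin M, ∑ y, bscBlock p (c.enc m) y ≤
      (∑ y, if c.dec y ≠ m then bscBlock p (c.enc m) y else 0) +
      ((∑ y, if c.dec y = m then θ else 0) +
        ∑ y, bscBlock p (c.enc m) y ^ (1 + t) * θ⁻¹ ^ t) := by
    intro m
    rw [← Finset.sum_add_distrib, ← Finset.sum_add_distrib]
    refine Finset.sum_le_sum fun y _ => ?_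
    have h0 := bscBlock_nonneg hp (c.enc m) y
    have h2 := le_add_rpow_mul h0 hθ ht.le
    have h3 : 0 ≤ bscBlock p (c.enc m) y ^ (1 + t) * θ⁻¹ ^ t := by positivity
    by_cases h : c.dec y = m
    · simpa [h] using h2
    · simpa [h] using h3
  have h2 := Finset.sum_le_sum fun m (_ : m ∈ Finset.univ) => h1 m
  simp_rw [← Finset.sum_mul, sum_bscBlock_rpow hp, sum_bscBlock hp] at h2
  rw [Finset.sum_add_distrib, Finset.sum_add_distrib] at h2
  have h3 : ∑ m : Fin M, ∑ y, (if c.dec y = m then θ else 0) = 2 ^ n * θ := by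
    rw [Finset.sum_comm]
    simp [ZMod.card]
  rw [h3] at h2
  simp only [Finset.sum_const, Finset.card_univ, Fintype.card_fin, nsmul_eq_mul, mul_one] at h2
  unfold BlockCode.errorProb
  rw [sub_le_iff_le_add', div_add' _ _ _ hM'.ne', le_div_iff₀ hM', add_mul,
    div_mul_cancel₀ _ hM'.ne']
  linarith

theorem BSCAchievable.le_one_sub_entropy {p R : ℝ} (hp : 0 ≤ p ∧ p ≤ 1)
    (h : BSCAchievable p R) : R ≤ 1 - entropy₂ p := by
  by_contra! hR
  -- The threshold will be `θ = 2 ^ (-c n)`: `c < entropy₂ p` makes outputs of likelihood above `θ`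
  -- rare, and `1 - R < c` makes `2 ^ n * θ / M` decay. The success probability then tends to 0,
  -- against an error below 1/2.
  obtain ⟨c, hc1, hc2⟩ := exists_between (show 1 - R < entropy₂ p by linarith)
  obtain ⟨t, ht, hρ⟩ := exists_powerSum_above_lt hp hc2
  have hF : 0 ≤ (1 - p) ^ (1 + t) + p ^ (1 + t) :=
    add_nonneg (Real.rpow_nonneg (sub_nonneg.2 hp.2) _) (Real.rpow_nonneg hp.1 _)
  have hr : (2 : ℝ) * 2 ^ (-c) / 2 ^ R < 1 := by
    rw [div_lt_one (by positivity)]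
    calc (2 : ℝ) * 2 ^ (-c) = 2 ^ (1 + -c) := by rw [Real.rpow_add two_pos, Real.rpow_one]
      _ < 2 ^ R := Real.rpow_lt_rpow_of_exponent_lt one_lt_two (by linarith)
  have l1 := tendsto_pow_atTop_nhds_zero_of_lt_one (by positivity) hρ
  have l2 := (tendsto_pow_atTop_nhds_zero_of_lt_one (by positivity) hr).const_mul 2
  have l := (l2.add l1).eventually
    (gt_mem_nhds (show (2 : ℝ) * 0 + 0 < 1 / 2 by norm_num))
  obtain ⟨n, hn, b, hb⟩ := (l.and (h.2 (1 / 2) (by norm_num))).exists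
  have hM := one_le_numMsg n h.1
  have hM' : (0 : ℝ) < numMsg n R := by exact_mod_cast hM
  have key := one_sub_errorProb_le hp hM b (θ := ((2 : ℝ) ^ (-c)) ^ n) (by positivity) ht
  have e1 : ((((2 : ℝ) ^ (-c)) ^ n)⁻¹) ^ t = (((2 : ℝ) ^ c) ^ t) ^ n := by
    rw [Real.rpow_neg two_pos.le, inv_pow, inv_inv,
      ← Real.rpow_pow_comm (x := 2 ^ c) (by positivity)]
  have e2 : 2 ^ n * ((2 : ℝ) ^ (-c)) ^ n / numMsg n R ≤ 2 * (2 * 2 ^ (-c) / 2 ^ R) ^ n := by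
    rw [div_le_iff₀ hM', div_pow, mul_pow]
    have := le_two_mul_numMsg n h.1
    have h3 : (0 : ℝ) < (2 ^ R) ^ n := by positivity
    rw [mul_div_assoc', div_mul_eq_mul_div, le_div_iff₀ h3]
    nlinarith [show (0 : ℝ) ≤ 2 ^ n * ((2 : ℝ) ^ (-c)) ^ n by positivity]
  rw [mul_pow ((1 - p) ^ (1 + t) + p ^ (1 + t))] at hn
  rw [e1] at key
  linarith

/-! ### Random linear codes -/

/-- For a uniformly random `G`, the word `v G` is uniform: `G ↦ v G` is additive and surjective, so
translation by a suitable `G₀` carries any fibre onto any other. -/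
theorem sum_ite_vecMul_eq {k n : ℕ} {v : Word k} (hv : v ≠ 0) (z : Word n) :
    (2 : ℝ) ^ n * ∑ G : Matrix (Fin k) (Fin n) (ZMod 2),
      (if Matrix.vecMul v G = z then (1 : ℝ) else 0) =
      Fintype.card (Matrix (Fin k) (Fin n) (ZMod 2)) := by
  classical
  obtain ⟨i, hi⟩ : ∃ i, v i ≠ 0 := by
    by_contra! h
    exact hv (funext h)
  have hsurj : ∀ w : Word n, ∃ G₀ : Matrix (Fin k) (Fin n) (ZMod 2), Matrix.vecMul v G₀ = w := by
    intro w
    -- Only row `i`, where `v` is nonzero, is used.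
    refine ⟨fun j => if j = i then (v i)⁻¹ • w else 0, ?_⟩
    ext l
    simp [Matrix.vecMul, dotProduct, ite_apply, hi]
  have hconst : ∀ w : Word n, ∑ G : Matrix (Fin k) (Fin n) (ZMod 2),
      (if Matrix.vecMul v G = w then (1 : ℝ) else 0) =
      ∑ G : Matrix (Fin k) (Fin n) (ZMod 2), (if Matrix.vecMul v G = z then (1 : ℝ) else 0) := by
    intro w
    obtain ⟨G₀, hG⟩ := hsurj (z - w)
    refine Fintype.sum_equiv (Equiv.addRight G₀) _ _ fun G => ?_
    simp [Matrix.vecMul_add, hG, ← eq_sub_iff_add_eq]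
  calc _ = ∑ w : Word n, ∑ G : Matrix (Fin k) (Fin n) (ZMod 2),
        (if Matrix.vecMul v G = w then (1 : ℝ) else 0) := by
        rw [Finset.sum_congr rfl fun w _ => hconst w]
        simp [ZMod.card]
    _ = _ := by
        rw [Finset.sum_comm]
        simp

theorem sum_ite_add_vecMul_mem {k n : ℕ} {v : Word k} (hv : v ≠ 0) (e : Word n)
    (T : Finset (Word n)) :
    ∑ G : Matrix (Fin k) (Fin n) (ZMod 2),
      (if e + Matrix.vecMul v G ∈ T then (1 : ℝ) else 0) =
      Fintype.card (Matrix (Fin k) (Fin n) (ZMod 2)) * (T.card / 2 ^ n) := by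
  have h : ∀ G : Matrix (Fin k) (Fin n) (ZMod 2),
      (if e + Matrix.vecMul v G ∈ T then (1 : ℝ) else 0) =
      ∑ z ∈ T, if Matrix.vecMul v G = z - e then (1 : ℝ) else 0 := by
    intro G
    simp_rw [eq_sub_iff_add_eq']
    rw [Finset.sum_ite_eq]
  simp_rw [h]
  rw [Finset.sum_comm]
  have h2 : ∀ z : Word n, ∑ G : Matrix (Fin k) (Fin n) (ZMod 2),
      (if Matrix.vecMul v G = z - e then (1 : ℝ) else 0) =
      Fintype.card (Matrix (Fin k) (Fin n) (ZMod 2)) / 2 ^ n := fun z => by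
    rw [eq_div_iff (by positivity), mul_comm, sum_ite_vecMul_eq hv]
  rw [Finset.sum_congr rfl fun z _ => h2 z, Finset.sum_const, nsmul_eq_mul]
  ring

open Classical in
/-- Decoding to a message whose codeword differs from the received word by an element of `T`. -/
noncomputable def setDecoder {n M : ℕ} [NeZero M] (f : Fin M → Word n) (T : Finset (Word n)) :
    BlockCode n M where
  enc := f
  dec y := if h : ∃ m, y - f m ∈ T then h.choose else 0

theorem exists_of_setDecoder_ne {n M : ℕ} [NeZero M] (f : Fin M → Word n) (T : Finset (Word n))
    {m : Fin M} {e : Word n} (h : (setDecoder f T).dec (f m + e) ≠ m) (he : e ∈ T) :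
    ∃ m', m' ≠ m ∧ e + (f m - f m') ∈ T := by
  have hex : ∃ m', f m + e - f m' ∈ T := ⟨m, by simpa using he⟩
  refine ⟨hex.choose, ?_, ?_⟩
  · simpa [setDecoder, hex] using h
  · convert hex.choose_spec using 1
    abel

/-- Union bound: an error requires that the noise miss `T` or that some wrong message also be
compatible with the output. -/
theorem setDecoder_errorProb_le {p : ℝ} (hp : 0 ≤ p ∧ p ≤ 1) {n M : ℕ} [NeZero M]
    (f : Fin M → Word n) (T : Finset (Word n)) :
    (setDecoder f T).errorProb p ≤ (∑ m : Fin M, ∑ e : Word n, bscBlock p 0 e *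
      ((if e ∉ T then 1 else 0) +
        ∑ m' : Fin M, if m' ≠ m ∧ e + (f m - f m') ∈ T then 1 else 0)) / M := by
  unfold BlockCode.errorProb
  refine div_le_div_of_nonneg_right (Finset.sum_le_sum fun m _ => ?_) (Nat.cast_nonneg _)
  rw [← Equiv.sum_comp (Equiv.addLeft (f m))]
  refine Finset.sum_le_sum fun e _ => ?_
  have hW := bscBlock_nonneg hp (0 : Word n) e
  have hs : ∀ m' : Fin M, (0 : ℝ) ≤ if m' ≠ m ∧ e + (f m - f m') ∈ T then 1 else 0 :=
    fun m' => by positivity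
  have hsum := Finset.sum_nonneg fun m' (_ : m' ∈ Finset.univ) => hs m'
  simp only [Equiv.coe_addLeft]
  rw [show (setDecoder f T).enc m = f m from rfl, bscBlock_add_left]
  by_cases h : (setDecoder f T).dec (f m + e) = m
  · refine (if_neg (not_not.2 h)).trans_le ?_
    positivity
  refine (if_pos h).trans_le ?_
  refine le_mul_of_one_le_right hW ?_
  by_cases he : e ∈ T
  · obtain ⟨m', hm'⟩ := exists_of_setDecoder_ne f T h he
    calc (1 : ℝ) = if m' ≠ m ∧ e + (f m - f m') ∈ T then 1 else 0 := by rw [if_pos hm']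
      _ ≤ ∑ m', _ := Finset.single_le_sum (fun m' _ => hs m') (Finset.mem_univ m')
      _ ≤ _ := le_add_of_nonneg_left (by positivity)
  · rw [if_pos he]
    exact le_add_of_nonneg_right hsum

/-- Distinct messages have `u m - u m' ≠ 0`, so over a random `G` a wrong message is compatible with
probability `T.card / 2 ^ n`. Some `G` does no worse than the average. Only differences of codewords
matter, so no random shift of the code is needed. -/
theorem exists_isLinearEncoder_errorProb_le {p : ℝ} (hp : 0 ≤ p ∧ p ≤ 1) {n M : ℕ} (hM : 0 < M)
    (T : Finset (Word n)) :
    ∃ c : BlockCode n M, IsLinearEncoder c.enc ∧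
      c.errorProb p ≤ (∑ e : Word n, if e ∉ T then bscBlock p 0 e else 0) +
        M * (T.card / 2 ^ n) := by
  classical
  have : NeZero M := ⟨hM.ne'⟩
  have hM' : (0 : ℝ) < M := by exact_mod_cast hM
  obtain ⟨u⟩ : Nonempty (Fin M ↪ Word (Nat.clog 2 M)) := by
    rw [Function.Embedding.nonempty_iff_card_le, card_word, Fintype.card_fin]
    exact Nat.le_pow_clog one_lt_two M
  set N : ℝ := (Fintype.card (Matrix (Fin (Nat.clog 2 M)) (Fin n) (ZMod 2)) : ℝ) with hN
  set B := (∑ e : Word n, if e ∉ T then bscBlock p 0 e else 0) + M * (T.card / 2 ^ n) with hB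
  suffices ∃ G ∈ (Finset.univ : Finset (Matrix (Fin (Nat.clog 2 M)) (Fin n) (ZMod 2))),
      (setDecoder (fun m => Matrix.vecMul (u m) G) T).errorProb p ≤ B by
    obtain ⟨G, -, hG⟩ := this
    exact ⟨_, ⟨G, u, u.injective, fun _ => rfl⟩, hG⟩
  refine Finset.exists_le_of_sum_le Finset.univ_nonempty ?_
  have hpair : ∀ (m m' : Fin M) (e : Word n),
      ∑ G : Matrix (Fin (Nat.clog 2 M)) (Fin n) (ZMod 2), (if m' ≠ m ∧
        e + (Matrix.vecMul (u m) G - Matrix.vecMul (u m') G) ∈ T then (1 : ℝ) else 0) ≤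
      N * (T.card / 2 ^ n) := by
    intro m m' e
    by_cases h : m' = m
    · simp only [h, ne_eq, not_true_eq_false, false_and, if_false, Finset.sum_const_zero]
      positivity
    · simp only [ne_eq, h, not_false_eq_true, true_and, ← Matrix.sub_vecMul]
      exact (sum_ite_add_vecMul_mem (sub_ne_zero.2 fun h' => h (u.injective h').symm) e T).le
  calc _ ≤ ∑ G : Matrix (Fin (Nat.clog 2 M)) (Fin n) (ZMod 2), _ :=
        Finset.sum_le_sum fun G _ => setDecoder_errorProb_le hp _ T
    _ = (∑ m : Fin M, ∑ e : Word n, bscBlock p 0 e * (N * (if e ∉ T then 1 else 0) +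
          ∑ m' : Fin M, ∑ G : Matrix (Fin (Nat.clog 2 M)) (Fin n) (ZMod 2), if m' ≠ m ∧
            e + (Matrix.vecMul (u m) G - Matrix.vecMul (u m') G) ∈ T then 1 else 0)) / M := by
        rw [← Finset.sum_div, Finset.sum_comm]
        congr 1
        refine Finset.sum_congr rfl fun m _ => ?_
        rw [Finset.sum_comm]
        refine Finset.sum_congr rfl fun e _ => ?_
        rw [← Finset.mul_sum, Finset.sum_add_distrib, Finset.sum_comm (s := Finset.univ
          (α := Matrix (Fin (Nat.clog 2 M)) (Fin n) (ZMod 2)))]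
        simp [hN]
    _ ≤ (∑ m : Fin M, ∑ e : Word n, bscBlock p 0 e * (N * (if e ∉ T then 1 else 0) +
          ∑ m' : Fin M, N * (T.card / 2 ^ n))) / M := by
        gcongr with m _ e _ m' _
        · exact bscBlock_nonneg hp _ _
        · exact hpair m m' e
    _ = N * B := by
        have h : ∀ e : Word n, bscBlock p 0 e * (N * (if e ∉ T then 1 else 0) +
            ∑ m' : Fin M, N * (T.card / 2 ^ n)) =
            N * (if e ∉ T then bscBlock p 0 e else 0) +
              bscBlock p 0 e * (N * (M * (T.card / 2 ^ n))) := by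
          intro e
          split_ifs <;> simp only [Finset.sum_const, Finset.card_univ, Fintype.card_fin,
            nsmul_eq_mul] <;> ring
        simp_rw [h, Finset.sum_add_distrib, ← Finset.mul_sum, ← Finset.sum_mul, sum_bscBlock hp]
        simp only [Finset.sum_const, Finset.card_univ, Fintype.card_fin, nsmul_eq_mul]
        rw [hB]
        field_simp
    _ = _ := by simp [hN]

theorem exists_isLinearEncoder_errorProb_lt {p R : ℝ} (hp : 0 ≤ p ∧ p ≤ 1) (hR0 : 0 ≤ R)
    (hR : R < 1 - entropy₂ p) {ε : ℝ} (hε : 0 < ε) :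
    ∀ᶠ n : ℕ in atTop, ∃ c : BlockCode n (numMsg n R), IsLinearEncoder c.enc ∧
      c.errorProb p < ε := by
  classical
  -- With `θ = 2 ^ (-c n)`, `entropy₂ p < c` leaves little noise mass below `θ`, and `c < 1 - R`
  -- makes `M * T.card / 2 ^ n` decay.
  obtain ⟨c, hc1, hc2⟩ := exists_between (show entropy₂ p < 1 - R by linarith)
  obtain ⟨t, ht0, ht1, hρ⟩ := exists_powerSum_below_lt hp hc1
  have hF : 0 ≤ (1 - p) ^ (1 - t) + p ^ (1 - t) :=
    add_nonneg (Real.rpow_nonneg (sub_nonneg.2 hp.2) _) (Real.rpow_nonneg hp.1 _)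
  have hr : (2 : ℝ) ^ R * (2 ^ c / 2) < 1 := by
    rw [← mul_div_assoc, div_lt_one two_pos, ← Real.rpow_add two_pos]
    calc (2 : ℝ) ^ (R + c) < 2 ^ (1 : ℝ) :=
          Real.rpow_lt_rpow_of_exponent_lt one_lt_two (by linarith)
      _ = 2 := Real.rpow_one 2
  have l1 := tendsto_pow_atTop_nhds_zero_of_lt_one (by positivity) hρ
  have l2 := tendsto_pow_atTop_nhds_zero_of_lt_one (by positivity) hr
  have l := (l1.add l2).eventually (gt_mem_nhds (show (0 : ℝ) + 0 < ε by simpa))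
  filter_upwards [l] with n hn
  set θ : ℝ := ((2 : ℝ) ^ (-c)) ^ n with hθ
  have hθ0 : 0 < θ := by positivity
  set T : Finset (Word n) := Finset.univ.filter fun e => θ ≤ bscBlock p 0 e with hT
  obtain ⟨b, hb, hle⟩ := exists_isLinearEncoder_errorProb_le hp (one_le_numMsg n hR0) T
  refine ⟨b, hb, lt_of_le_of_lt (hle.trans (add_le_add ?_ ?_)) hn⟩
  · calc _ ≤ ∑ e : Word n, bscBlock p 0 e ^ (1 - t) * θ ^ t := by
          refine Finset.sum_le_sum fun e _ => ?_
          have h0 := bscBlock_nonneg hp (0 : Word n) e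
          by_cases h : θ ≤ bscBlock p 0 e
          · simpa [hT, h] using by positivity
          · simpa [hT, h] using le_rpow_mul_of_le h0 (not_le.1 h).le ht0.le
      _ = _ := by
          rw [← Finset.sum_mul, sum_bscBlock_rpow hp, mul_pow, hθ,
            ← Real.rpow_pow_comm (x := 2 ^ (-c)) (by positivity)]
  -- Every element of `T` has mass at least `θ`, and the total mass is 1.
  · have hcard : T.card * θ ≤ 1 := by
      rw [← sum_bscBlock hp (0 : Word n), ← nsmul_eq_mul]
      exact (Finset.card_nsmul_le_sum T _ θ fun e he => (Finset.mem_filter.1 he).2).trans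
        (Finset.sum_le_univ_sum_of_nonneg fun e => bscBlock_nonneg hp _ _)
    have hcard' : (T.card : ℝ) ≤ ((2 : ℝ) ^ c) ^ n := by
      rw [← le_div_iff₀ hθ0] at hcard
      refine hcard.trans_eq ?_
      rw [hθ, Real.rpow_neg two_pos.le, inv_pow, one_div, inv_inv]
    rw [mul_pow, div_pow]
    gcongr
    exact numMsg_le n R

/-! ### Rate zero, closures of achievable rates, and capacity -/

theorem isLinearEncoder_of_subsingleton {n M : ℕ} (hM : M = 1) (f : Fin M → Word n)
    (hf : ∀ m, f m = 0) : IsLinearEncoder f := by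
  subst hM
  exact ⟨0, 0, Function.injective_of_subsingleton _, fun m => by simp [hf]⟩

/-- `R` is achievable with linear codes. -/
def BSCLinearAchievable (p R : ℝ) : Prop :=
  0 ≤ R ∧ ∀ ε : ℝ, 0 < ε → ∀ᶠ n : ℕ in atTop,
    ∃ c : BlockCode n (numMsg n R), IsLinearEncoder c.enc ∧ c.errorProb p < ε

theorem BSCLinearAchievable.bscAchievable {p R : ℝ} (h : BSCLinearAchievable p R) :
    BSCAchievable p R :=
  ⟨h.1, fun ε hε => (h.2 ε hε).mono fun _ ⟨c, _, hc⟩ => ⟨c, hc⟩⟩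

theorem bscLinearAchievable_of_lt {p R : ℝ} (hp : 0 ≤ p ∧ p ≤ 1) (hR0 : 0 ≤ R)
    (hR : R < 1 - entropy₂ p) : BSCLinearAchievable p R :=
  ⟨hR0, fun _ hε => exists_isLinearEncoder_errorProb_lt hp hR0 hR hε⟩

/-- Needed separately because at capacity 0 no nonnegative rate lies strictly below capacity. A
single message is never decoded wrongly. -/
theorem bscLinearAchievable_zero (p : ℝ) : BSCLinearAchievable p 0 := by
  refine ⟨le_rfl, fun ε hε => Eventually.of_forall fun n => ?_⟩
  have h1 := numMsg_zero_right n
  have : Subsingleton (Fin (numMsg n 0)) := by rw [h1]; infer_instance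
  refine ⟨⟨fun _ => 0, fun _ => ⟨0, by omega⟩⟩,
    isLinearEncoder_of_subsingleton h1 _ fun _ => rfl, ?_⟩
  have h2 : ∀ a b : Fin (numMsg n 0), (a ≠ b) = False := fun a b => by
    simp [Subsingleton.elim a b]
  simpa only [BlockCode.errorProb, h2, if_false, Finset.sum_const_zero, zero_div] using hε

theorem closure_eq_Icc_of_achievable {C : ℝ} (hC : 0 ≤ C) {S : Set ℝ} (h0 : 0 ∈ S)
    (h1 : Set.Ico 0 C ⊆ S) (h2 : S ⊆ Set.Icc 0 C) : closure S = Set.Icc 0 C := by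
  refine (closure_minimal h2 isClosed_Icc).antisymm ?_
  rcases hC.eq_or_lt with rfl | hC
  · simpa using subset_closure h0
  · rw [← closure_Ico hC.ne]
    exact closure_mono h1

theorem closure_bscAchievable {p : ℝ} (hp : 0 ≤ p ∧ p ≤ 1) :
    closure {R | BSCAchievable p R} = Set.Icc 0 (1 - entropy₂ p) :=
  closure_eq_Icc_of_achievable (sub_nonneg.2 (entropy₂_le_one p))
    (bscLinearAchievable_zero p).bscAchievable
    (fun _ h => (bscLinearAchievable_of_lt hp h.1 h.2).bscAchievable)
    fun _ h => ⟨h.1, h.le_one_sub_entropy hp⟩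

theorem closure_bscLinearAchievable {p : ℝ} (hp : 0 ≤ p ∧ p ≤ 1) :
    closure {R | BSCLinearAchievable p R} = Set.Icc 0 (1 - entropy₂ p) :=
  closure_eq_Icc_of_achievable (sub_nonneg.2 (entropy₂_le_one p))
    (bscLinearAchievable_zero p)
    (fun _ h => bscLinearAchievable_of_lt hp h.1 h.2)
    fun _ h => ⟨h.1, h.bscAchievable.le_one_sub_entropy hp⟩

theorem isBSCCapacity_one_sub_entropy {p : ℝ} (hp : 0 ≤ p ∧ p ≤ 1) :
    IsBSCCapacity p (1 - entropy₂ p) := by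
  have h := isLUB_Icc (sub_nonneg.2 (entropy₂_le_one p))
  rw [← closure_bscAchievable hp] at h
  exact ⟨fun R hR => h.1 (subset_closure hR), fun b hb =>
    h.2 fun R hR => closure_minimal (show _ ⊆ Set.Iic b from hb) isClosed_Iic hR⟩

/-! ### Marginals of the network noise -/

/-- Probability of an error pattern on the four links in a single channel use. -/
def letterProb (p : Link → ℝ) (v : Link → ZMod 2) : ℝ := ∏ l, if v l = 1 then p l else 1 - p l

/-- A function on links as a quadruple. -/
def linkFunEquiv (α : Type*) : (Link → α) ≃ α × α × α × α where
  toFun f := (f .l13, f .l23, f .l34, f .l14)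
  invFun a l := match l with
    | .l13 => a.1
    | .l23 => a.2.1
    | .l34 => a.2.2.1
    | .l14 => a.2.2.2
  left_inv f := by funext l; cases l <;> rfl
  right_inv _ := rfl

theorem prod_link {β : Type*} [CommMonoid β] (f : Link → β) :
    ∏ l, f l = f .l13 * (f .l23 * (f .l34 * f .l14)) := by
  change ∏ l ∈ {Link.l13, Link.l23, Link.l34, Link.l14}, f l = _
  rw [Finset.prod_insert (by decide), Finset.prod_insert (by decide),
    Finset.prod_insert (by decide), Finset.prod_singleton]

theorem sum_linkFun (F : (Link → ZMod 2) → ℝ) :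
    ∑ v, F v = ∑ a : ZMod 2, ∑ b : ZMod 2, ∑ c : ZMod 2, ∑ d : ZMod 2,
      F ((linkFunEquiv (ZMod 2)).symm (a, b, c, d)) := by
  rw [← Equiv.sum_comp (linkFunEquiv (ZMod 2)).symm, Fintype.sum_prod_type]
  simp_rw [Fintype.sum_prod_type]

/-- Transposing the pattern from links by times to times by links makes both its probability and the
letterwise constraint factor over channel uses. This is memorylessness of any letterwise function of
the noise. -/
theorem sum_noise_ite {n : ℕ} (p : Link → ℝ) (φ : (Link → ZMod 2) → ZMod 2) (z : Word n) :
    (∑ e : Noise n, if (fun i => φ fun l => e l i) = z then noiseProb p e else 0) =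
      ∏ i, ∑ v, if φ v = z i then letterProb p v else 0 := by
  rw [Fintype.prod_sum, ← Equiv.sum_comp (Equiv.piComm fun (_ : Link) (_ : Fin n) => ZMod 2)]
  refine Finset.sum_congr rfl fun e _ => ?_
  rw [Finset.prod_ite_zero]
  simp only [Equiv.piComm_apply, Finset.mem_univ, forall_true_left, funext_iff, noiseProb, letterProb]
  rw [Finset.prod_comm]
  rfl

theorem sum_letterProb_l14 (p : Link → ℝ) (z : ZMod 2) :
    (∑ v : Link → ZMod 2, if v .l14 = z then letterProb p v else 0) = bsc (p .l14) 0 z := by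
  rw [sum_linkFun]
  simp only [letterProb, prod_link, sum_zmod_two, linkFunEquiv, Equiv.coe_fn_symm_mk]
  rcases zmod_two_eq_zero_or_one z with rfl | rfl <;> simp [bsc] <;> ring

theorem sum_letterProb_all (p : Link → ℝ) (z : ZMod 2) :
    (∑ v : Link → ZMod 2, if v .l13 + v .l23 + v .l34 + v .l14 = z then letterProb p v else 0) =
      bsc (pEquiv p) 0 z := by
  have h2 : (1 : ZMod 2) + 1 = 0 := rfl
  rw [sum_linkFun]
  simp only [letterProb, prod_link, sum_zmod_two, linkFunEquiv, Equiv.coe_fn_symm_mk]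
  rcases zmod_two_eq_zero_or_one z with rfl | rfl <;> simp [bsc, h2, pEquiv] <;> ring

theorem bscBlock_eq_zero_left (p : ℝ) {n : ℕ} (x y : Word n) :
    bscBlock p x y = bscBlock p 0 (y - x) := by
  rw [← bscBlock_add_left p x, add_sub_cancel]

theorem sum_noise_Y14 {n : ℕ} (p : Link → ℝ) (xA y : Word n) :
    (∑ e : Noise n, if Y14 xA e = y then noiseProb p e else 0) = bscBlock (p .l14) xA y := by
  rw [bscBlock_eq_zero_left, bscBlock]
  simp_rw [Pi.zero_apply, ← sum_letterProb_l14]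
  rw [← sum_noise_ite p (fun v => v .l14) (y - xA)]
  refine Finset.sum_congr rfl fun e _ => ?_
  simp only [Y14, eq_sub_iff_add_eq']
  rfl

theorem Y34_add_Y14 {n : ℕ} (xA xB : Word n) (e : Noise n) :
    Y34 xA xB e + Y14 xA e = xB + (e .l13 + e .l23 + e .l34 + e .l14) := by
  have h : xA + xA = 0 := funext fun i => CharTwo.add_self_eq_zero (xA i)
  calc _ = (xA + xA) + (xB + (e .l13 + e .l23 + e .l34 + e .l14)) := by
        simp only [Y34, X34, Y13, Y23, Y14]; abel
    _ = _ := by rw [h, zero_add]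

theorem sum_noise_Y34_add_Y14 {n : ℕ} (p : Link → ℝ) (xA xB y : Word n) :
    (∑ e : Noise n, if Y34 xA xB e + Y14 xA e = y then noiseProb p e else 0) =
      bscBlock (pEquiv p) xB y := by
  rw [bscBlock_eq_zero_left, bscBlock]
  simp_rw [Pi.zero_apply, ← sum_letterProb_all]
  rw [← sum_noise_ite p (fun v => v .l13 + v .l23 + v .l34 + v .l14) (y - xB)]
  refine Finset.sum_congr rfl fun e _ => ?_
  simp only [Y34_add_Y14, eq_sub_iff_add_eq']
  rfl

/-- Both `pEquiv p` and `1 - pEquiv p` are sums of nonnegative letter probabilities, over odd and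
even patterns respectively. -/
theorem pEquiv_mem {p : Link → ℝ} (hp : ∀ l, 0 ≤ p l ∧ p l ≤ 1) :
    0 ≤ pEquiv p ∧ pEquiv p ≤ 1 := by
  have h0 : ∀ l, 0 ≤ p l := fun l => (hp l).1
  have h1 : ∀ l, 0 ≤ 1 - p l := fun l => sub_nonneg.2 (hp l).2
  have hnn : ∀ v, 0 ≤ letterProb p v := fun v =>
    Finset.prod_nonneg fun l _ => by split_ifs; exacts [h0 l, h1 l]
  have key : ∀ z, 0 ≤ bsc (pEquiv p) 0 z := fun z => by
    rw [← sum_letterProb_all]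
    exact Finset.sum_nonneg fun v _ => by split_ifs; exacts [hnn v, le_rfl]
  exact ⟨by simpa [bsc] using key 1, by simpa [bsc] using key 0⟩

theorem noiseProb_nonneg {p : Link → ℝ} (hp : ∀ l, 0 ≤ p l ∧ p l ≤ 1) {n : ℕ} (e : Noise n) :
    0 ≤ noiseProb p e :=
  Finset.prod_nonneg fun l _ => Finset.prod_nonneg fun _ _ => by
    split_ifs
    exacts [(hp l).1, sub_nonneg.2 (hp l).2]

/-! ### Reduction of the network to two point-to-point channels -/

/-- The code for message `A` contained in a network code. -/
def NCCode.codeA {n MA MB : ℕ} (c : NCCode n MA MB) : BlockCode n MA := ⟨c.encA, c.decA⟩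

/-- The code for message `B` contained in a network code. -/
def NCCode.codeB {n MA MB : ℕ} (c : NCCode n MA MB) : BlockCode n MB := ⟨c.encB, c.decB⟩

theorem sum_ite_eq_sum_fiber {α β : Type*} [Fintype α] [Fintype β] [DecidableEq β]
    (g : α → β) (w : α → ℝ) (W : β → ℝ) (P : β → Prop) [DecidablePred P]
    (h : ∀ y, (∑ e, if g e = y then w e else 0) = W y) :
    (∑ e, if P (g e) then w e else 0) = ∑ y, if P y then W y else 0 := by
  simp_rw [← h]
  have h' : ∀ y, (if P y then ∑ e, (if g e = y then w e else 0) else 0) =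
      ∑ e, if g e = y then (if P y then w e else 0) else 0 := by
    intro y
    split_ifs <;> simp
  simp_rw [h']
  rw [Finset.sum_comm]
  simp

theorem errorProb_codeA {n MA MB : ℕ} (hB : 0 < MB) (c : NCCode n MA MB) (p : Link → ℝ) :
    c.codeA.errorProb (p .l14) = (∑ a : Fin MA, ∑ _b : Fin MB, ∑ e : Noise n,
      if c.decA (Y14 (c.encA a) e) ≠ a then noiseProb p e else 0) / ((MA : ℝ) * (MB : ℝ)) := by
  have hB' : (MB : ℝ) ≠ 0 := by exact_mod_cast hB.ne'
  have h : ∀ a : Fin MA, (∑ e : Noise n,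
      if c.decA (Y14 (c.encA a) e) ≠ a then noiseProb p e else 0) = _ := fun a =>
    sum_ite_eq_sum_fiber _ _ _ (fun y => c.decA y ≠ a) (sum_noise_Y14 p (c.encA a))
  simp_rw [h]
  simp only [Finset.sum_const, Finset.card_univ, Fintype.card_fin, nsmul_eq_mul]
  rw [← Finset.mul_sum, mul_comm (MA : ℝ), mul_div_mul_left _ _ hB']
  rfl

/-- The law of `Y34 + Y14` does not depend on `a`, so averaging over `a` changes nothing. -/
theorem errorProb_codeB {n MA MB : ℕ} (hA : 0 < MA) (c : NCCode n MA MB) (p : Link → ℝ) :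
    c.codeB.errorProb (pEquiv p) = (∑ a : Fin MA, ∑ b : Fin MB, ∑ e : Noise n,
      if c.decB (Y34 (c.encA a) (c.encB b) e + Y14 (c.encA a) e) ≠ b then noiseProb p e else 0) /
      ((MA : ℝ) * (MB : ℝ)) := by
  have hA' : (MA : ℝ) ≠ 0 := by exact_mod_cast hA.ne'
  have h : ∀ (a : Fin MA) (b : Fin MB), (∑ e : Noise n,
      if c.decB (Y34 (c.encA a) (c.encB b) e + Y14 (c.encA a) e) ≠ b
        then noiseProb p e else 0) = _ := fun a b =>
    sum_ite_eq_sum_fiber _ _ _ (fun y => c.decB y ≠ b)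
      (sum_noise_Y34_add_Y14 p (c.encA a) (c.encB b))
  simp_rw [h]
  simp only [Finset.sum_const, Finset.card_univ, Fintype.card_fin, nsmul_eq_mul]
  rw [mul_div_mul_left _ _ hA']
  rfl

variable {p : Link → ℝ}

theorem errorProb_codeA_le (hp : ∀ l, 0 ≤ p l ∧ p l ≤ 1) {n MA MB : ℕ} (hB : 0 < MB)
    (c : NCCode n MA MB) : c.codeA.errorProb (p .l14) ≤ c.errorProb p := by
  rw [errorProb_codeA hB, NCCode.errorProb]
  gcongr with a _ b _ e _
  have := noiseProb_nonneg hp e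
  simp only [NCCode.estimate, ne_eq, Prod.mk.injEq]
  split_ifs <;> first | linarith | tauto

theorem errorProb_codeB_le (hp : ∀ l, 0 ≤ p l ∧ p l ≤ 1) {n MA MB : ℕ} (hA : 0 < MA)
    (c : NCCode n MA MB) : c.codeB.errorProb (pEquiv p) ≤ c.errorProb p := by
  rw [errorProb_codeB hA, NCCode.errorProb]
  gcongr with a _ b _ e _
  have := noiseProb_nonneg hp e
  simp only [NCCode.estimate, ne_eq, Prod.mk.injEq]
  split_ifs <;> first | linarith | tauto

theorem errorProb_le_add (hp : ∀ l, 0 ≤ p l ∧ p l ≤ 1) {n MA MB : ℕ} (hA : 0 < MA) (hB : 0 < MB)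
    (c : NCCode n MA MB) :
    c.errorProb p ≤ c.codeA.errorProb (p .l14) + c.codeB.errorProb (pEquiv p) := by
  rw [errorProb_codeA hB, errorProb_codeB hA, NCCode.errorProb, ← add_div]
  simp_rw [← Finset.sum_add_distrib]
  gcongr with a _ b _ e _
  have := noiseProb_nonneg hp e
  simp only [NCCode.estimate, ne_eq, Prod.mk.injEq]
  split_ifs <;> first | linarith | tauto

/-- A network code is just a pair of block codes, one for each marginal channel; conversely two
codes with errors below `ε / 2` combine by the union bound. -/
theorem ncAchievable_iff (hp : ∀ l, 0 ≤ p l ∧ p l ≤ 1) (R : ℝ × ℝ) :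
    NCAchievable p R ↔ BSCAchievable (p .l14) R.1 ∧ BSCAchievable (pEquiv p) R.2 := by
  constructor
  · rintro ⟨h1, h2, h⟩
    refine ⟨⟨h1, fun ε hε => (h ε hε).mono fun n ⟨c, hc⟩ => ?_⟩,
      ⟨h2, fun ε hε => (h ε hε).mono fun n ⟨c, hc⟩ => ?_⟩⟩
    · exact ⟨c.codeA, (errorProb_codeA_le hp (one_le_numMsg n h2) c).trans_lt hc⟩
    · exact ⟨c.codeB, (errorProb_codeB_le hp (one_le_numMsg n h1) c).trans_lt hc⟩
  · rintro ⟨hA, hB⟩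
    refine ⟨hA.1, hB.1, fun ε hε => ?_⟩
    filter_upwards [hA.2 _ (half_pos hε), hB.2 _ (half_pos hε)] with n ⟨a, ha⟩ ⟨b, hb⟩
    exact ⟨⟨a.enc, b.enc, a.dec, b.dec⟩, (errorProb_le_add hp (one_le_numMsg n hA.1)
      (one_le_numMsg n hB.1) _).trans_lt ((add_lt_add ha hb).trans_eq (add_halves ε))⟩

theorem ncLinearAchievable_iff (hp : ∀ l, 0 ≤ p l ∧ p l ≤ 1) (R : ℝ × ℝ) :
    NCLinearAchievable p R ↔
      BSCLinearAchievable (p .l14) R.1 ∧ BSCLinearAchievable (pEquiv p) R.2 := by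
  constructor
  · rintro ⟨h1, h2, h⟩
    refine ⟨⟨h1, fun ε hε => (h ε hε).mono fun n ⟨c, hl, hc⟩ => ?_⟩,
      ⟨h2, fun ε hε => (h ε hε).mono fun n ⟨c, hl, hc⟩ => ?_⟩⟩
    · exact ⟨c.codeA, hl.1, (errorProb_codeA_le hp (one_le_numMsg n h2) c).trans_lt hc⟩
    · exact ⟨c.codeB, hl.2, (errorProb_codeB_le hp (one_le_numMsg n h1) c).trans_lt hc⟩
  · rintro ⟨hA, hB⟩
    refine ⟨hA.1, hB.1, fun ε hε => ?_⟩
    filter_upwards [hA.2 _ (half_pos hε), hB.2 _ (half_pos hε)] with n ⟨a, hla, ha⟩ ⟨b, hlb, hb⟩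
    exact ⟨⟨a.enc, b.enc, a.dec, b.dec⟩, ⟨hla, hlb⟩, (errorProb_le_add hp (one_le_numMsg n hA.1)
      (one_le_numMsg n hB.1) _).trans_lt ((add_lt_add ha hb).trans_eq (add_halves ε))⟩

/-! ### The rate region as a rectangle -/

theorem Icc_prod_Icc_eq_convexHull (C D : ℝ) :
    Set.Icc 0 C ×ˢ Set.Icc 0 D =
      convexHull ℝ {R : ℝ × ℝ | 0 ≤ R.1 ∧ 0 ≤ R.2 ∧ R.1 ≤ C ∧ R.2 ≤ D} := by
  have h : {R : ℝ × ℝ | 0 ≤ R.1 ∧ 0 ≤ R.2 ∧ R.1 ≤ C ∧ R.2 ≤ D} =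
      Set.Icc 0 C ×ˢ Set.Icc 0 D := by
    ext R
    simp only [Set.mem_ofPred_eq, Set.mem_prod, Set.mem_Icc]
    tauto
  rw [h, ((convex_Icc 0 C).prod (convex_Icc 0 D)).convexHull_eq]

theorem ncRegion_eq (hp : ∀ l, 0 ≤ p l ∧ p l ≤ 1) :
    ncRegion p = Set.Icc 0 (1 - entropy₂ (p .l14)) ×ˢ Set.Icc 0 (1 - entropy₂ (pEquiv p)) := by
  rw [← closure_bscAchievable (hp .l14), ← closure_bscAchievable (pEquiv_mem hp),
    ← closure_prod_eq, ncRegion]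
  exact congrArg closure (Set.ext fun R => ncAchievable_iff hp R)

theorem ncLinearRegion_eq (hp : ∀ l, 0 ≤ p l ∧ p l ≤ 1) :
    ncLinearRegion p =
      Set.Icc 0 (1 - entropy₂ (p .l14)) ×ˢ Set.Icc 0 (1 - entropy₂ (pEquiv p)) := by
  rw [← closure_bscLinearAchievable (hp .l14), ← closure_bscLinearAchievable (pEquiv_mem hp),
    ← closure_prod_eq, ncLinearRegion]
  exact congrArg closure (Set.ext fun R => ncLinearAchievable_iff hp R)

end RelayNet

theorem theorem1 (p : RelayNet.Link → ℝ) (hp : ∀ l, 0 ≤ p l ∧ p l ≤ 1) :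
    -- the channel from the codeword of `B` to `Y₃₄ + Y₁₄` is a BSC with crossover probability `p''`
    (∀ (n : ℕ) (xA xB y : RelayNet.Word n),
      (∑ e : RelayNet.Noise n,
        if RelayNet.Y34 xA xB e + RelayNet.Y14 xA e = y then RelayNet.noiseProb p e else 0)
      = RelayNet.bscBlock (RelayNet.pEquiv p) xB y) ∧
    -- `1 - H(p₁₄)` and `1 - H(p'')` are the capacities of the two channels
    RelayNet.IsBSCCapacity (p .l14) (1 - RelayNet.entropy₂ (p .l14)) ∧
    RelayNet.IsBSCCapacity (RelayNet.pEquiv p) (1 - RelayNet.entropy₂ (RelayNet.pEquiv p)) ∧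
    -- the rate region, with arbitrary codes and with linear codes
    RelayNet.ncRegion p =
      convexHull ℝ {R : ℝ × ℝ | 0 ≤ R.1 ∧ 0 ≤ R.2 ∧
        R.1 ≤ 1 - RelayNet.entropy₂ (p .l14) ∧
        R.2 ≤ 1 - RelayNet.entropy₂ (RelayNet.pEquiv p)} ∧
    RelayNet.ncLinearRegion p =
      convexHull ℝ {R : ℝ × ℝ | 0 ≤ R.1 ∧ 0 ≤ R.2 ∧
        R.1 ≤ 1 - RelayNet.entropy₂ (p .l14) ∧
        R.2 ≤ 1 - RelayNet.entropy₂ (RelayNet.pEquiv p)} :=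
  ⟨fun _ xA xB y => RelayNet.sum_noise_Y34_add_Y14 p xA xB y,
    RelayNet.isBSCCapacity_one_sub_entropy (hp .l14),
    RelayNet.isBSCCapacity_one_sub_entropy (RelayNet.pEquiv_mem hp),
    (RelayNet.ncRegion_eq hp).trans (RelayNet.Icc_prod_Icc_eq_convexHull _ _),
    (RelayNet.ncLinearRegion_eq hp).trans (RelayNet.Icc_prod_Icc_eq_convexHull _ _)⟩
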